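/- An inglenook puzzle is given by positive integers $w,s,h,m_1,\dots,m_s$ with $w<h+m_1+\cdots+m_s$, a set $W$ of $w$ wagons, and sets $S$ (starting positions) and $F$ (finishing positions) of positions. Here a \emph{position} is a sequence $(W_0,W_1,\dots,W_s)$ of pairwise disjoint ordered subsets of $W$ with union $W$, such that $|W_0|\le h$ and $|W_i|\le m_i$ for $1\le i\le s$. ($W_0$ lists the wagons in the headshunt, from the shunting engine to the points; for $i\ge 1$, $W_i$ lists the wagons in Siding $i$, from the points to the buffer stop.) A \emph{move} takes a position $(W_0,\dots,W_s)$ to a different position $(W_0',\dots,W_s')$ such that for some $r\in\{1,\dots,s\}$ we have $W_i=W_i'$ for all $i\in\{1,\dots,s\}\setminus\{r\}$, and the concatenation of $W_0$ and $W_r$ equals the concatenation of $W_0'$ and $W_r'$. A starting position is \emph{solved} in $n$ moves when a sequence of $n$ moves takes it to some position in $F$, and the puzzle \emph{can always be solved} if every position in $S$ can be taken to a position in $F$ by a finite sequence of moves. The puzzle is \emph{natural} if $S$ is closed under permuting the wagons amongst themselves and, for some $z\in\{1,\dots,s\}$ and some wagon $\omega\in W$, all positions in $F$ have $\omega$ as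 the last wagon (nearest the buffer stop) in Siding $z$. Theorem. Let $w\ge 1$ be an integer. (i) If a natural inglenook puzzle with $w$ wagons can always be solved, then each of its starting positions can be solved in at most $2w^2+12w-10$ moves. (ii) There are a natural inglenook puzzle with $w$ wagons that can always be solved and a starting position of this puzzle such that every sequence of moves solving it from this position has at least $(w^2-1)/2$ moves. -/

import Mathlib

namespace Inglenook

/-- A position of an inglenook puzzle with wagon set `W`, headshunt length `h` and `s` sidings of
lengths `m 0, …, m (s - 1)`. Track `0` is the headshunt, its wagons listed from the shunting engine
to the points; track `i.succ` is the siding of length `m i`, its wagons listed from the points to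
the buffer stop. Ordered subsets of `W` are lists without repetitions. -/
@[ext]
structure Position (W : Type*) {s : ℕ} (h : ℕ) (m : Fin s → ℕ) where
  track : Fin (s + 1) → List W
  nodup : ∀ i, (track i).Nodup
  cover : ∀ a : W, ∃ i, a ∈ track i
  disjoint : ∀ i j, i ≠ j → List.Disjoint (track i) (track j)
  siding_le : ∀ i : Fin s, (track i.succ).length ≤ m i
  headshunt_le : (track 0).length ≤ h

variable {W : Type*} {s h : ℕ} {m : Fin s → ℕ}

/-- The position obtained by permuting the wagons amongst themselves. -/
def Position.permute (σ : Equiv.Perm W) (p : Position W h m) : Position W h m where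
  track i := (p.track i).map σ
  nodup i := (p.nodup i).map σ.injective
  cover a := by
    obtain ⟨i, hi⟩ := p.cover (σ.symm a)
    exact ⟨i, List.mem_map.2 ⟨_, hi, σ.apply_symm_apply a⟩⟩
  disjoint i j hij := List.disjoint_map σ.injective (p.disjoint i j hij)
  siding_le i := by simpa using p.siding_le i
  headshunt_le := by simpa using p.headshunt_le

/-- A move: the two positions are distinct, and for some siding `r` all other sidings agree and
the concatenation of the headshunt with siding `r` is the same in both positions. -/
def IsMove (p q : Position W h m) : Prop :=
  p ≠ q ∧ ∃ r : Fin s, (∀ i : Fin s, i ≠ r → p.track i.succ = q.track i.succ) ∧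
    p.track 0 ++ p.track r.succ = q.track 0 ++ q.track r.succ

/-- The inglenook graph: vertices are the positions, edges are the moves. -/
def graph (W : Type*) {s : ℕ} (h : ℕ) (m : Fin s → ℕ) : SimpleGraph (Position W h m) where
  Adj := IsMove
  symm := ⟨fun _ _ ⟨hne, r, h₁, h₂⟩ => ⟨hne.symm, r, fun i hi => (h₁ i hi).symm, h₂.symm⟩⟩
  loopless := ⟨fun _ hp => hp.1 rfl⟩

/-- An inglenook puzzle with wagon set `W`: `s` sidings of lengths `m i`, a headshunt of length
`h`, a set `S` of starting positions and a set `F` of finishing positions. -/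
structure Puzzle (W : Type*) [Fintype W] where
  s : ℕ
  h : ℕ
  m : Fin s → ℕ
  wagons_pos : 0 < Fintype.card W
  s_pos : 0 < s
  h_pos : 0 < h
  m_pos : ∀ i, 0 < m i
  wagons_lt : Fintype.card W < h + ∑ i, m i
  S : Set (Position W h m)
  F : Set (Position W h m)

namespace Puzzle

variable [Fintype W]

/-- The graph on which the puzzle is played. -/
def graph (P : Puzzle W) : SimpleGraph (Position W P.h P.m) :=
  Inglenook.graph W P.h P.m

/-- `S` is closed under permuting the wagons, and for some siding `z` and some wagon `ω`, every
finishing position has `ω` as the last wagon (nearest the buffer stop) of siding `z`. -/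
def IsNatural (P : Puzzle W) : Prop :=
  (∀ p ∈ P.S, ∀ σ : Equiv.Perm W, p.permute σ ∈ P.S) ∧
    ∃ (z : Fin P.s) (ω : W), ∀ q ∈ P.F, (q.track z.succ).getLast? = some ω

/-- Every starting position has a finishing position in its connected component. -/
def AlwaysSolvable (P : Puzzle W) : Prop :=
  ∀ p ∈ P.S, ∃ q ∈ P.F, P.graph.Reachable p q

end Puzzle

end Inglenook

namespace Inglenook

open Function Finset

/-! Upper bound. Suppose a wagon-valued function of positions is constant along moves and commutes
with renaming the wagons. Renaming the start makes its value arbitrary, so a finishing position can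
be found with any prescribed value (`Puzzle.IsNatural.exists_finish`), which may clash with `ω`
being last in siding `z`. Clashing invariants exist when the sidings cannot hold all wagons, when
some siding is at least as long as the total free space, and when there are too few tracks. So a
solvable natural puzzle with a start and at least two wagons has a `Good` yard
(`Puzzle.IsNatural.good`). In a `Good` yard any two positions are connected. Clearing the headshunt
costs at most w moves at either end. In between, `Within.rearrange` inducts on the number k of
wagons: `Within.place` brings a suitable wagon to its target buffer stop in at most 4k + 8 moves,
and then that siding is regarded as one shorter. `Good.exists_pred` chooses the siding so that the
yard stays `Good`. The costs add up to 2w² + 10w - 10. Lower bound. With headshunt length 2 and two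
sidings, `disorder` drops by at most one per move, and reversing w wagons in a siding requires a
drop of w² - w. -/

/-- All wagons of a yard. -/
def contents {α ι : Type*} [Fintype ι] (x : List α × (ι → List α)) : Multiset α :=
  (x.1 : Multiset α) + ∑ i, (x.2 i : Multiset α)

theorem card_contents {α ι : Type*} [Fintype ι] (x : List α × (ι → List α)) :
    Multiset.card (contents x) = x.1.length + ∑ i, (x.2 i).length := by
  simp [contents]

/-! ### Shunting in yards of lists, and draining sidings -/

section Yard

variable {α ι : Type*} [DecidableEq ι]

/-- One shunt between a headshunt of length `h` and sidings of lengths `c`: a block of wagons is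
pulled out of a siding or pushed into it. -/
inductive Step (h : ℕ) (c : ι → ℕ) : List α × (ι → List α) → List α × (ι → List α) → Prop
  | pull (H A B : List α) (T : ι → List α) (r : ι) (hT : T r = A ++ B)
      (hA : H.length + A.length ≤ h) : Step h c (H, T) (H ++ A, update T r B)
  | push (H A : List α) (T : ι → List α) (r : ι) (hA : A.length + (T r).length ≤ c r) :
      Step h c (H ++ A, T) (H, update T r (A ++ T r))

/-- `Within h c n x y`: the yard `y` can be reached from `x` by at most `n` shunts. -/
inductive Within (h : ℕ) (c : ι → ℕ) :
    ℕ → List α × (ι → List α) → List α × (ι → List α) → Prop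
  | refl (n : ℕ) (x : List α × (ι → List α)) : Within h c n x x
  | tail {n : ℕ} {x y z : List α × (ι → List α)} (hxy : Within h c n x y) (hyz : Step h c y z) :
      Within h c (n + 1) x z

/-- The track lengths are respected. -/
def Fits (h : ℕ) (c : ι → ℕ) (x : List α × (ι → List α)) : Prop :=
  x.1.length ≤ h ∧ ∀ i, (x.2 i).length ≤ c i

variable {h : ℕ} {c : ι → ℕ} {n m : ℕ} {x y z : List α × (ι → List α)}

theorem Within.mono (hxy : Within h c n x y) (hnm : n ≤ m) : Within h c m x y := by
  induction hxy generalizing m with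
  | refl n x => exact .refl _ _
  | tail _ hs ih =>
    obtain ⟨m, rfl⟩ : ∃ m', m = m' + 1 := ⟨m - 1, by omega⟩
    exact .tail (ih (by omega)) hs

theorem Within.trans (hxy : Within h c n x y) (hyz : Within h c m y z) :
    Within h c (n + m) x z := by
  induction hyz with
  | refl m x => exact hxy.mono (by omega)
  | tail _ hs ih => exact .tail (ih hxy) hs

theorem Step.within (hxy : Step h c x y) : Within h c 1 x y :=
  .tail (.refl 0 x) hxy

theorem Step.fits (hxy : Step h c x y) (hx : Fits h c x) : Fits h c y := by
  obtain ⟨hx₁, hx₂⟩ := hx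
  cases hxy with
  | pull H A B T r hT hA =>
    refine ⟨by simpa using hA, fun i => ?_⟩
    have := hx₂ i
    by_cases hi : i = r
    · subst hi; simp_all; omega
    · simpa [hi] using this
  | push H A T r hA =>
    refine ⟨by simp at hx₁ ⊢; omega, fun i => ?_⟩
    by_cases hi : i = r
    · subst hi; simpa using hA
    · simpa [hi] using hx₂ i

theorem Within.fits (hxy : Within h c n x y) (hx : Fits h c x) : Fits h c y := by
  induction hxy with
  | refl n x => exact hx
  | tail _ hs ih => exact hs.fits (ih hx)

/-- Wagons standing at the buffer stops of the sidings may be ignored. -/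
theorem Within.append_bottom {c' : ι → ℕ} (B : ι → List α) (hc : ∀ i, c' i + (B i).length ≤ c i)
    (hxy : Within h c' n x y) :
    Within h c n (x.1, fun i => x.2 i ++ B i) (y.1, fun i => y.2 i ++ B i) := by
  induction hxy with
  | refl n x => exact .refl _ _
  | tail _ hs ih =>
    refine .tail ih ?_
    cases hs with
    | pull H A C T r hT hA =>
      have := Step.pull (c := c) H A (C ++ B r) (fun i => T i ++ B i) r (by simp [hT]) hA
      convert this using 2
      ext1 i
      by_cases hi : i = r
      · subst hi; simp
      · simp [hi]
    | push H A T r hA =>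
      have := Step.push (h := h) (c := c) H A (fun i => T i ++ B i) r
        (by have := hc r; simp; omega)
      convert this using 2
      ext1 i
      by_cases hi : i = r
      · subst hi; simp
      · simp [hi]

/-- Moving one wagon from siding `i` to siding `j`. -/
theorem Within.transfer {H : List α} {T : ι → List α} {i j : ι} {t : α} {B : List α}
    (hi : T i = t :: B) (hij : i ≠ j) (hj : (T j).length < c j) (hH : H.length + 1 ≤ h) :
    Within h c 2 (H, T) (H, update (update T i B) j (t :: T j)) := by
  have h₁ : Step h c (H, T) (H ++ [t], update T i B) := Step.pull H [t] B T i (by simp [hi]) hH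
  have h₂ := Step.push (h := h) (c := c) H [t] (update T i B) j (by simp [hij.symm]; omega)
  have := h₁.within.tail h₂
  simpa [hij.symm] using this

variable [Fintype ι]

theorem sum_coe_update (T : ι → List α) (r : ι) (B : List α) :
    (∑ i, (update T r B i : Multiset α)) = B + ∑ i ∈ {r}ᶜ, (T i : Multiset α) := by
  rw [Fintype.sum_eq_add_sum_compl r]
  congr 1
  · simp
  · exact Finset.sum_congr rfl fun i hi => by rw [update_of_ne (by simpa using hi)]

theorem Step.contents_eq (hxy : Step h c x y) : contents x = contents y := by
  cases hxy with
  | pull H A B T r hT hA =>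
    simp only [contents, sum_coe_update,
      Fintype.sum_eq_add_sum_compl r (fun i => (T i : Multiset α)), hT, ← Multiset.coe_add]
    simp only [add_assoc]
  | push H A T r hA =>
    simp only [contents, sum_coe_update,
      Fintype.sum_eq_add_sum_compl r (fun i => (T i : Multiset α)), ← Multiset.coe_add]
    simp only [add_assoc]

theorem Within.contents_eq (hxy : Within h c n x y) : contents x = contents y := by
  induction hxy with
  | refl n x => rfl
  | tail _ hs ih => exact ih.trans hs.contents_eq

theorem Within.length_eq (hxy : Within h c n x y) :
    x.1.length + ∑ i, (x.2 i).length = y.1.length + ∑ i, (y.2 i).length := by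
  rw [← card_contents, ← card_contents, hxy.contents_eq]

/-- Wagons can be moved one by one from siding `i` to the sidings outside `S` as long as these have
free places. -/
theorem Within.drain (S : Finset ι) {i : ι} (hi : i ∈ S) {H : List α} (hH : H.length + 1 ≤ h)
    (A B : List α) (T : ι → List α) (hT : T i = A ++ B)
    (hS : ∑ j ∈ Sᶜ, (T j).length + A.length ≤ ∑ j ∈ Sᶜ, c j) :
    ∃ T' : ι → List α, Within h c (2 * A.length) (H, T) (H, T') ∧ T' i = B ∧
      (∀ j ∈ S, j ≠ i → T' j = T j) ∧
      ∑ j ∈ Sᶜ, (T' j).length = ∑ j ∈ Sᶜ, (T j).length + A.length := by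
  induction A generalizing T with
  | nil => exact ⟨T, .refl _ _, by simpa using hT, fun _ _ _ => rfl, by simp⟩
  | cons t A ih =>
    obtain ⟨j, hj, hlt⟩ : ∃ j ∈ Sᶜ, (T j).length < c j :=
      Finset.exists_lt_of_sum_lt (by simp at hS; omega)
    have hjS : j ∉ S := by simpa using hj
    have hij : i ≠ j := fun e => hjS (e ▸ hi)
    have h₁ := Within.transfer (c := c) (h := h) (H := H) (B := A ++ B) (by simpa using hT) hij hlt hH
    set T₁ := update (update T i (A ++ B)) j (t :: T j) with hT₁
    have hsum : ∑ x ∈ Sᶜ, (T₁ x).length = ∑ x ∈ Sᶜ, (T x).length + 1 := by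
      have : ∀ x ∈ Sᶜ, (T₁ x).length = (T x).length + if x = j then 1 else 0 := by
        intro x hx
        have hxi : x ≠ i := fun e => by subst e; simp at hx; exact hx hi
        by_cases hxj : x = j
        · subst hxj; simp [hT₁]
        · simp [hT₁, hxj, hxi]
      rw [Finset.sum_congr rfl this, Finset.sum_add_distrib, Finset.sum_ite_eq']
      simp [hjS]
    obtain ⟨T', h₂, h₃, h₄, h₅⟩ := ih T₁ (by simp [hT₁, hij]) (by simp at hS; omega)
    refine ⟨T', (h₁.trans h₂).mono (by simp; omega), h₃, fun x hx hxi => ?_, ?_⟩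
    · rw [h₄ x hx hxi]
      have hxj : x ≠ j := fun e => hjS (e ▸ hx)
      simp [hT₁, hxj, hxi]
    · simp; omega

/-- If there are enough places in the sidings, the headshunt can be emptied. -/
theorem Within.clear_headshunt (H : List α) (T : ι → List α)
    (hk : H.length + ∑ i, (T i).length ≤ ∑ i, c i) :
    ∃ T', Within h c H.length (H, T) ([], T') := by
  induction H using List.reverseRecOn generalizing T with
  | nil => exact ⟨T, .refl _ _⟩
  | append_singleton H a ih =>
    obtain ⟨j, -, hj⟩ : ∃ j ∈ (univ : Finset ι), (T j).length < c j :=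
      Finset.exists_lt_of_sum_lt (by simp at hk; omega)
    have h₁ := (Step.push (h := h) (c := c) H [a] T j (by simp; omega)).within
    have h₂ := h₁.length_eq
    simp only [List.length_append, List.length_singleton] at h₂ hk
    obtain ⟨T', h₃⟩ := ih (update T j ([a] ++ T j)) (by omega)
    exact ⟨T', (h₁.trans h₃).mono (by simp; omega)⟩

end Yard

/-! ### Bringing one wagon to a buffer stop -/

section Stage

variable {α ι : Type*} [DecidableEq ι] {h : ℕ} {c : ι → ℕ}

/-- Of the wagons in the headshunt all but the one next to the points are put into siding `r`. -/
theorem Within.keep_last {A : List α} {x : α} {T : ι → List α} {u r : ι} (hur : u ≠ r)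
    (hu : (T u).length < c u) (hr : A.length + (T r).length ≤ c r) (hh : 1 ≤ h) :
    ∃ T', Within h c 3 (A ++ [x], T) ([x], T') := by
  have h₁ := Step.push (h := h) (c := c) A [x] T u (by simp; omega)
  have h₂ := Step.push (h := h) (c := c) [] A (update T u ([x] ++ T u)) r
    (by simpa [hur.symm] using hr)
  rw [List.nil_append] at h₂
  have h₃ := Step.pull (h := h) (c := c) [] [x] (T u)
    (update (update T u ([x] ++ T u)) r (A ++ update T u ([x] ++ T u) r)) u
    (by simp [hur]) (by simpa using hh)
  exact ⟨_, (h₁.within.tail h₂).tail h₃⟩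

/-- With `x` on top of siding `u` and few wagons in siding `z`, the wagon `x` can be brought to the
buffer stop of siding `z`. -/
theorem Within.bury {T : ι → List α} (hT : ∀ i, (T i).length ≤ c i) {x : α} {u z : ι}
    (huz : u ≠ z) {U : List α} (hu : T u = x :: U) (hz : (T z).length + 1 ≤ h) (hc : 0 < c z) :
    ∃ T' B, Within h c 5 ([], T) ([], T') ∧ T' z = B ++ [x] := by
  have h₁ := Step.pull (h := h) (c := c) [] (T z) [] T z (by simp) (by simp; omega)
  have h₂ := Step.pull (h := h) (c := c) ([] ++ T z) [x] U (update T z []) u (by simp [huz, hu])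
    (by simpa using hz)
  have h₃ := Step.push (h := h) (c := c) ([] ++ T z) [x] (update (update T z []) u U) z
    (by simp [huz.symm]; omega)
  have h₄ := (h₁.within.tail h₂).tail h₃
  set T₁ := update (update (update T z []) u U) z
    ([x] ++ update (update T z []) u U z) with hT₁
  have hTz : T₁ z = [x] := by simp [hT₁, huz.symm]
  have hTu : T₁ u = U := by simp [hT₁, huz]
  rw [List.nil_append] at h₄
  rcases (hT z).lt_or_eq with hlt | heq
  · have h₅ := Step.push (h := h) (c := c) [] (T z) T₁ z (by simp [hTz]; omega)
    exact ⟨_, T z, (h₄.tail h₅).mono (by omega), by simp [hTz]⟩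
  -- If `z` was full, `x` has taken one of its places; the leftover wagon `t` goes to the place that
  -- `x` vacated in `u`.
  · obtain ⟨t, Z, hZ⟩ : ∃ t Z, T z = t :: Z := List.exists_cons_of_length_pos (by omega)
    rw [hZ] at heq h₄
    have h₅ := Step.push (h := h) (c := c) [t] Z T₁ z (by simp [hTz] at heq ⊢; omega)
    have h₆ := Step.push (h := h) (c := c) [] [t] (update T₁ z (Z ++ T₁ z)) u
      (by have := hT u; simp [hTu, hu, huz] at this ⊢; omega)
    exact ⟨_, Z, (h₄.tail h₅).tail h₆, by simp [huz.symm, hTz]⟩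

theorem update_append_bottom {T : ι → List α} {z : ι} {B : List α} {x : α} (hz : T z = B ++ [x]) :
    (fun i => update T z B i ++ update (fun _ => []) z [x] i) = T := by
  ext1 i
  by_cases hi : i = z
  · subst hi; simp [hz]
  · simp [hi]

theorem length_update_le {T : ι → List α} (hT : ∀ i, (T i).length ≤ c i) {z : ι} {B : List α}
    {x : α} (hz : T z = B ++ [x]) (i : ι) :
    (update T z B i).length ≤ update c z (c z - 1) i := by
  by_cases hi : i = z
  · subst hi
    have := hT i
    simp [hz] at this ⊢
    omega
  · simpa [hi] using hT i

variable [Fintype ι]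

theorem length_eq_of_sum_compl_le {S : Finset ι} {T : ι → List α} (hT : ∀ i, (T i).length ≤ c i)
    (hS : ∑ i ∈ Sᶜ, c i ≤ ∑ i ∈ Sᶜ, (T i).length) {i : ι} (hi : i ∉ S) : (T i).length = c i :=
  (Finset.sum_eq_sum_iff_of_le fun i _ => hT i).1
    (le_antisymm (Finset.sum_le_sum fun i _ => hT i) hS) i (by simpa using hi)

/-- Wagons above `x` that do not fit in the headshunt together with it are first moved to other
sidings; `hc` leaves a free place `u` there, which `Within.keep_last` uses to separate `x` from the
rest. -/
theorem Within.take_in_hand {T : ι → List α} (hT : ∀ i, (T i).length ≤ c i) (hh : 2 ≤ h)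
    (hN : ∀ z, ∃ u, u ≠ z ∧ 0 < c u) {k : ℕ} (hk : ∑ i, (T i).length = k) (hk2 : 2 ≤ k)
    {r : ι} (hc : k + c r < h + ∑ i, c i) {A B : List α} {x : α} (hr : T r = A ++ x :: B) :
    ∃ T', Within h c (2 * k + 2) ([], T) ([x], T') := by
  have hTr : (T r).length = A.length + B.length + 1 := by simp [hr]; omega
  have hTr' := hT r
  have hs₁ := Fintype.sum_eq_add_sum_compl r c
  have hs₂ := Fintype.sum_eq_add_sum_compl r (fun i => (T i).length)
  rcases lt_or_ge (∑ i ∈ {r}ᶜ, (T i).length) (∑ i ∈ {r}ᶜ, c i) with hlt | hge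
  -- The truncated difference is the number of surplus wagons, zero if `A ++ [x]` already fits in
  -- the headshunt.
  · obtain ⟨A₁, A₂, rfl, hg⟩ : ∃ A₁ A₂, A = A₁ ++ A₂ ∧ A₁.length = A.length + 1 - h :=
      ⟨_, _, (List.take_append_drop (A.length + 1 - h) A).symm, by simp; omega⟩
    simp only [List.length_append] at hg hTr
    obtain ⟨T₁, h₁, h₂, -, h₃⟩ := Within.drain (h := h) (c := c) {r} (mem_singleton_self r)
      (H := []) (by simp; omega) A₁ (A₂ ++ x :: B) T (by simp [hr]) (by omega)
    obtain ⟨u, hu, hlt'⟩ : ∃ u ∈ ({r} : Finset ι)ᶜ, (T₁ u).length < c u :=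
      Finset.exists_lt_of_sum_lt (by omega)
    have hur : u ≠ r := by simpa using hu
    have h₄ := Step.pull (h := h) (c := c) [] (A₂ ++ [x]) B T₁ r (by simp [h₂]) (by simp; omega)
    obtain ⟨T', h₅⟩ := Within.keep_last (A := A₂) (x := x) (T := update T₁ r B) (h := h) hur
      (by simpa [hur] using hlt') (by simp; omega) (by omega)
    exact ⟨T', ((h₁.tail h₄).trans h₅).mono (by omega)⟩
  -- All other sidings are full, so `hc` says that `T r` has fewer than `h` wagons. The headshunt
  -- thus has room for one wagon `t` of `u` besides `A ++ [x]`; dropping `t` in `r` opens a place in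
  -- `u`.
  · obtain ⟨u, hur, hu⟩ := hN r
    have hfull := length_eq_of_sum_compl_le hT hge (i := u) (by simpa using hur)
    obtain ⟨t, U, hU⟩ : ∃ t U, T u = t :: U := List.exists_cons_of_length_pos (by omega)
    have h₁ := Step.pull (h := h) (c := c) [] (A ++ [x]) B T r (by simp [hr]) (by simp; omega)
    have h₂ := Step.pull (h := h) (c := c) ([] ++ (A ++ [x])) [t] U (update T r B) u
      (by simp [hur, hU]) (by simp; omega)
    have h₃ := Step.push (h := h) (c := c) ([] ++ (A ++ [x])) [t] (update (update T r B) u U) r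
      (by simp [hur.symm]; omega)
    have h₄ := (h₁.within.tail h₂).tail h₃
    rw [List.nil_append] at h₄
    obtain ⟨T', h₅⟩ := Within.keep_last (A := A) (x := x) (h := h) (c := c)
      (T := update (update (update T r B) u U) r ([t] ++ update (update T r B) u U r)) hur
      (by simp [hU] at hfull; simp [hur]; omega) (by simp [hur.symm]; omega) (by omega)
    exact ⟨T', (h₄.trans h₅).mono (by omega)⟩

/-- This prepares `Within.bury`: the headshunt must be able to take all of siding `z` and then `x`
as well. -/
theorem Within.put_down {T : ι → List α} (hT : ∀ i, (T i).length ≤ c i) (hh : 2 ≤ h)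
    (hN : ∀ z, ∃ u, u ≠ z ∧ 0 < c u) {k : ℕ} (hk : 1 + ∑ i, (T i).length = k) (hk2 : 2 ≤ k)
    (hkc : k ≤ ∑ i, c i) {z : ι} (hc : k + c z < h + ∑ i, c i) (x : α) :
    ∃ T' u U, Within h c (2 * k - 1) ([x], T) ([], T') ∧ u ≠ z ∧ T' u = x :: U ∧
      (T' z).length + 1 ≤ h := by
  have hTz := hT z
  have hs₁ := Fintype.sum_eq_add_sum_compl z c
  have hs₂ := Fintype.sum_eq_add_sum_compl z (fun i => (T i).length)
  rcases lt_or_ge (∑ i ∈ {z}ᶜ, (T i).length + ((T z).length + 1 - h)) (∑ i ∈ {z}ᶜ, c i)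
    with hlt | hge
  · obtain ⟨A₁, A₂, hA, hg⟩ : ∃ A₁ A₂, T z = A₁ ++ A₂ ∧ A₁.length = (T z).length + 1 - h :=
      ⟨_, _, (List.take_append_drop ((T z).length + 1 - h) (T z)).symm, by simp; omega⟩
    obtain ⟨T₁, h₁, h₂, -, h₃⟩ := Within.drain (h := h) (c := c) {z} (mem_singleton_self z)
      (H := [x]) (by simp; omega) A₁ A₂ T hA (by omega)
    obtain ⟨u, hu, hlt'⟩ : ∃ u ∈ ({z} : Finset ι)ᶜ, (T₁ u).length < c u :=
      Finset.exists_lt_of_sum_lt (by omega)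
    have huz : u ≠ z := by simpa using hu
    have h₄ := Step.push (h := h) (c := c) [] [x] T₁ u (by simp; omega)
    have hlen : (T z).length = A₁.length + A₂.length := by simp [hA]
    refine ⟨_, u, T₁ u, (h₁.tail h₄).mono (by omega), huz, by simp, ?_⟩
    simp [huz.symm, h₂]
    omega
  -- By `hc` this case occurs only if the other sidings are full and `z` has at most `h - 2` wagons.
  -- By `hkc`, siding `z` has a free place, so it can take a wagon of `u` to make way for `x`.
  · obtain ⟨u, huz, hu⟩ := hN z
    have hfull := length_eq_of_sum_compl_le hT (S := {z}) (by omega) (i := u) (by simpa using huz)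
    obtain ⟨t, U, hU⟩ : ∃ t U, T u = t :: U := List.exists_cons_of_length_pos (by omega)
    have h₁ := Within.transfer (h := h) (c := c) (H := [x]) hU huz (by omega) (by simp; omega)
    have h₂ := Step.push (h := h) (c := c) [] [x] (update (update T u U) z (t :: T z)) u
      (by simp [hU] at hfull; simp [huz]; omega)
    refine ⟨_, u, U, (h₁.tail h₂).mono (by omega), huz, by simp [huz], ?_⟩
    simp [huz.symm]
    omega

/-- With a short headshunt, `x` can be brought to the top of a siding other than `z`. -/
theorem Within.expose {T : ι → List α} (hh : 1 ≤ h)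
    {k : ℕ} (hk : ∑ i, (T i).length = k) {r : ι} (hc : k + c r ≤ ∑ i, c i) (z : ι)
    {A B : List α} {x : α} (hr : T r = A ++ x :: B) :
    ∃ T' p U, Within h c (2 * k) ([], T) ([], T') ∧ p ≠ z ∧ T' p = x :: U := by
  have hTr : (T r).length = A.length + B.length + 1 := by simp [hr]; omega
  have hs₁ := Fintype.sum_eq_add_sum_compl r c
  have hs₂ := Fintype.sum_eq_add_sum_compl r (fun i => (T i).length)
  obtain ⟨T₁, h₁, h₂, -, h₃⟩ := Within.drain (h := h) (c := c) {r} (mem_singleton_self r)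
    (H := []) (by simp; omega) A (x :: B) T hr (by omega)
  by_cases hrz : r = z
  · obtain ⟨u, hu, hlt'⟩ : ∃ u ∈ ({r} : Finset ι)ᶜ, (T₁ u).length < c u :=
      Finset.exists_lt_of_sum_lt (by omega)
    have hur : u ≠ r := by simpa using hu
    have h₄ := Within.transfer (h := h) (c := c) (H := []) h₂ hur.symm hlt' (by simpa using hh)
    exact ⟨_, u, T₁ u, (h₁.trans h₄).mono (by omega), hrz ▸ hur, by simp⟩
  · exact ⟨T₁, r, B, h₁.mono (by omega), hrz, h₂⟩

theorem sum_eq_add_add_sum_compl {z p : ι} (hpz : p ≠ z) (f : ι → ℕ) :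
    ∑ i, f i = f z + f p + ∑ i ∈ ({z, p} : Finset ι)ᶜ, f i := by
  rw [← Finset.sum_add_sum_compl {z, p}, Finset.sum_pair hpz.symm]

/-- The sidings other than `z` can together hold all wagons; as `p` is full, the room for those of
`z` lies outside both `z` and `p`. -/
theorem Within.empty_of_full {T : ι → List α} (hh : 1 ≤ h) {k : ℕ} (hk : ∑ i, (T i).length = k)
    {z : ι} (hc : k + c z ≤ ∑ i, c i) {p : ι} (hpz : p ≠ z) (hp : (T p).length = c p) :
    ∃ T', Within h c (2 * (T z).length) ([], T) ([], T') ∧ T' z = [] ∧ T' p = T p := by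
  have hs₁ := sum_eq_add_add_sum_compl hpz c
  have hs₂ := sum_eq_add_add_sum_compl hpz (fun i => (T i).length)
  obtain ⟨T₁, h₁, h₂, h₃, -⟩ := Within.drain (h := h) (c := c) {z, p} (by simp)
    (H := []) (i := z) (by simp; omega) (T z) [] T (by simp) (by omega)
  exact ⟨T₁, h₁, h₂, h₃ p (by simp) hpz⟩

/-- With a short headshunt, siding `z` can be emptied while `x` stays on top of a siding. -/
theorem Within.empty {T : ι → List α} (hT : ∀ i, (T i).length ≤ c i) (hh : 1 ≤ h)
    {k : ℕ} (hk : ∑ i, (T i).length = k) (hc : ∀ i, k + c i ≤ ∑ i, c i) {z p : ι} (hpz : p ≠ z)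
    (hN : ∃ v, v ≠ z ∧ v ≠ p ∧ 0 < c v) {x : α} {U : List α} (hp : T p = x :: U) :
    ∃ T' q V, Within h c (2 * k + 4) ([], T) ([], T') ∧ q ≠ z ∧ T' q = x :: V ∧ T' z = [] := by
  have hs₁ := sum_eq_add_add_sum_compl hpz c
  have hs₂ := sum_eq_add_add_sum_compl hpz (fun i => (T i).length)
  have hTp : (T p).length = U.length + 1 := by simp [hp]
  have hle := Finset.sum_le_sum (s := ({z, p} : Finset ι)ᶜ) fun i _ => hT i
  rcases le_or_gt (∑ i ∈ {z, p}ᶜ, (T i).length + (T z).length) (∑ i ∈ {z, p}ᶜ, c i)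
    with hlt | hge
  · obtain ⟨T₁, h₁, h₂, h₃, -⟩ := Within.drain (h := h) (c := c) {z, p} (by simp)
      (H := []) (i := z) (by simp; omega) (T z) [] T (by simp) (by omega)
    exact ⟨T₁, p, U, h₁.mono (by omega), hpz, (h₃ p (by simp) hpz).trans hp, h₂⟩
  -- Only the siding under `x` has the missing room. After the third sidings are filled from `z`, a
  -- full one, `v`, gives a wagon to `z` and receives `x`: now `x` tops a full siding and `p` may be
  -- covered.
  · set g := ∑ i ∈ {z, p}ᶜ, c i - ∑ i ∈ {z, p}ᶜ, (T i).length with hg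
    obtain ⟨A₁, A₂, hA, hg'⟩ : ∃ A₁ A₂, T z = A₁ ++ A₂ ∧ A₁.length = g :=
      ⟨_, _, (List.take_append_drop g (T z)).symm, by simp; omega⟩
    have hlen : (T z).length = A₁.length + A₂.length := by simp [hA]
    obtain ⟨T₁, h₁, h₂, h₃, h₄⟩ := Within.drain (h := h) (c := c) {z, p} (by simp)
      (H := []) (i := z) (by simp; omega) A₁ A₂ T hA (by omega)
    have hT₁ := (h₁.fits ⟨by simp, hT⟩).2
    simp only at hT₁
    have hTp₁ := (h₃ p (by simp) hpz).trans hp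
    obtain ⟨v, hvz, hvp, hv⟩ := hN
    have hfull := length_eq_of_sum_compl_le hT₁ (S := {z, p}) (by omega) (i := v)
      (by simp [hvz, hvp])
    obtain ⟨t, V, hV⟩ : ∃ t V, T₁ v = t :: V := List.exists_cons_of_length_pos (by omega)
    -- `hcp` gives the free place in `z` for `t`; `hcz` gives the room for finally emptying `z`.
    have hcz := hc z
    have hcp := hc p
    have h₅ := Within.transfer (h := h) (c := c) (H := []) hV hvz (by rw [h₂]; omega)
      (by simpa using hh)
    set T₂ := update (update T₁ v V) z (t :: T₁ z) with hT₂
    have h₆ := Within.transfer (h := h) (c := c) (H := []) (T := T₂) (i := p) (j := v) (t := x)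
      (B := U) (by simp [hT₂, hpz, hvp.symm, hTp₁]) hvp.symm
      (by simp [hV] at hfull; simp [hT₂, hvz]; omega) (by simpa using hh)
    have h₇ := (h₁.trans h₅).trans h₆
    obtain ⟨T', h₈, h₉, h₁₀⟩ := Within.empty_of_full (c := c) (z := z) (p := v)
      (T := update (update T₂ p U) v (x :: T₂ v)) hh (k := k)
      (by simpa [hk] using h₇.length_eq.symm) hcz hvz
      (by simp [hV] at hfull; simp [hT₂, hvz]; omega)
    refine ⟨T', v, V, (h₇.trans h₈).mono ?_, hvz, ?_, h₉⟩
    · simp [hT₂, hvz.symm, hpz.symm, h₂]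
      omega
    · simp [h₁₀, hT₂, hvz]

end Stage

/-! ### Arbitrary rearrangement by induction on the number of wagons -/

section Rearrange

variable {α ι : Type*} [DecidableEq ι] [Fintype ι] {h : ℕ} {c : ι → ℕ} {k : ℕ}

/-- The conditions under which `k` wagons can be arbitrarily rearranged on a headshunt of length
`h` and sidings of lengths `c`, some of which may be zero. -/
structure Good (k h : ℕ) (c : ι → ℕ) : Prop where
  one_le : 1 ≤ h
  le_sum : k ≤ ∑ i, c i
  add_lt : ∀ i, k + c i < h + ∑ i, c i
  sidings : (2 ≤ h ∧ 2 ≤ #{i | 0 < c i}) ∨ 3 ≤ #{i | 0 < c i}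

theorem Good.exists_ne {ι : Type*} [Fintype ι] {c : ι → ℕ} (hg : Good k h c) (z : ι) : ∃ u, u ≠ z ∧ 0 < c u := by
  obtain ⟨u, hu, huz⟩ := Finset.exists_mem_ne (s := ({i | 0 < c i} : Finset ι))
    (by have := hg.sidings; omega) z
  exact ⟨u, huz, by simpa using hu⟩

theorem Good.exists_ne_ne (hg : Good k h c) (hh : h < 2) (z p : ι) :
    ∃ u, u ≠ z ∧ u ≠ p ∧ 0 < c u := by
  obtain ⟨u, hu, huz⟩ := Finset.exists_mem_notMem_of_card_lt_card
    (s := {z, p}) (t := ({i | 0 < c i} : Finset ι))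
    (by have := hg.sidings; have := Finset.card_le_two (a := z) (b := p); omega)
  simp at hu huz
  exact ⟨u, huz.1, huz.2, hu⟩

theorem sum_update_pred {z : ι} (hz : 0 < c z) :
    ∑ i, update c z (c z - 1) i + 1 = ∑ i, c i := by
  rw [Fintype.sum_eq_add_sum_compl z, Fintype.sum_eq_add_sum_compl z c,
    Finset.sum_congr rfl fun i (hi : i ∈ ({z} : Finset ι)ᶜ) =>
      update_of_ne (f := c) (by simpa using hi) (c z - 1)]
  simp
  omega

/-- In some siding a target wagon can be fixed at the buffer stop without spoiling `Good`. -/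
theorem Good.exists_pred (hg : Good (k + 1) h c) (hk : 2 ≤ k) {t : ι → ℕ} (htc : ∀ i, t i ≤ c i)
    (ht : ∑ i, t i = k + 1) : ∃ z, 0 < t z ∧ Good k h (update c z (c z - 1)) := by
  obtain ⟨h₁, h₂, h₃, h₄⟩ := hg
  suffices hs : ∃ z, 0 < t z ∧ ((2 ≤ h ∧ 2 ≤ #{i | 0 < update c z (c z - 1) i}) ∨
      3 ≤ #{i | 0 < update c z (c z - 1) i}) by
    obtain ⟨z, hz, hs⟩ := hs
    have hsum := sum_update_pred (c := c) (z := z) (by have := htc z; omega)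
    refine ⟨z, hz, h₁, by omega, fun i => ?_, hs⟩
    have hi : update c z (c z - 1) i ≤ c i := by
      by_cases hiz : i = z
      · subst hiz; simp
      · simp [hiz]
    have := h₃ i
    omega
  by_cases h2 : ∃ z, 0 < t z ∧ 2 ≤ c z
  -- A siding of length at least 2 stays nonzero when shortened.
  · obtain ⟨z, hz, hcz⟩ := h2
    refine ⟨z, hz, ?_⟩
    have : ({i | 0 < update c z (c z - 1) i} : Finset ι) = ({i | 0 < c i} : Finset ι) := by
      ext i
      by_cases hiz : i = z
      · subst hiz; simp; omega
      · simp [hiz]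
    rwa [this]
  · push Not at h2
    have hle : ∀ i ∈ (univ : Finset ι), t i ≤ if 0 < c i then 1 else 0 := by
      intro i _
      have := htc i
      have := h2 i
      split_ifs <;> omega
    have hN : k + 1 ≤ #{i | 0 < c i} := by
      rw [← ht, Finset.card_filter]
      exact Finset.sum_le_sum hle
    obtain ⟨z, hz⟩ : ∃ z, 0 < t z := by
      by_contra! hcon
      have : ∑ i, t i = 0 := Finset.sum_eq_zero fun i _ => by have := hcon i; omega
      omega
    refine ⟨z, hz, ?_⟩
    have hsub : ({i | 0 < c i} : Finset ι).erase z ⊆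
        ({i | 0 < update c z (c z - 1) i} : Finset ι) := by
      intro i hi
      simp at hi
      simp [hi.1, hi.2]
    have hcard := (Finset.pred_card_le_card_erase (s := ({i | 0 < c i} : Finset ι)) (a := z)).trans
      (Finset.card_le_card hsub)
    by_cases hh : 2 ≤ h
    · omega
    -- Now `h = 1`, so three nonzero sidings must survive. With exactly `k + 1` of them, each would
    -- have length one and be filled by the target, contradicting `h₃ z`; otherwise at least four
    -- exist.
    by_cases hN' : #{i | 0 < c i} = k + 1
    · have heq := (Finset.sum_eq_sum_iff_of_le hle).1 (by rw [ht, ← Finset.card_filter, hN'])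
      have hc : ∀ i, c i ≤ if 0 < c i then 1 else 0 := by
        intro i
        have h5 := heq i (mem_univ i)
        have h6 := h2 i
        split_ifs at h5 ⊢ <;> omega
      have hle' := Finset.sum_le_sum fun i (_ : i ∈ (univ : Finset ι)) => hc i
      rw [← Finset.card_filter] at hle'
      have := h₃ z
      have := htc z
      omega
    · omega

/-- With `h ≥ 2` the wagon is carried in the headshunt and buried under the contents of `z`. With `h
= 1` it cannot be carried while others move, so it waits on top of a siding while `z` is emptied.
Either way 4k + 6 moves suffice. -/
theorem Within.place {T : ι → List α} (hT : ∀ i, (T i).length ≤ c i)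
    (hk : ∑ i, (T i).length = k) (hk2 : 2 ≤ k) (hg : Good k h c) {r z : ι} {A B : List α} {x : α}
    (hr : T r = A ++ x :: B) (hz : 0 < c z) :
    ∃ T' B', Within h c (4 * k + 8) ([], T) ([], T') ∧ T' z = B' ++ [x] := by
  by_cases hh : 2 ≤ h
  · obtain ⟨T₁, h₁⟩ := Within.take_in_hand (c := c) hT hh hg.exists_ne hk hk2 (hg.add_lt r) hr
    have hT₁ := h₁.fits ⟨by simp, hT⟩
    obtain ⟨T₂, u, U, h₂, huz, hU, hlen⟩ := Within.put_down (c := c) (T := T₁) hT₁.2 hh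
      hg.exists_ne (k := k) (by simpa [hk] using h₁.length_eq.symm) hk2 hg.le_sum (hg.add_lt z) x
    obtain ⟨T₃, B', h₃, h₄⟩ := Within.bury (h₂.fits hT₁).2 huz hU hlen hz
    exact ⟨T₃, B', ((h₁.trans h₂).trans h₃).mono (by omega), h₄⟩
  · have hc : ∀ i, k + c i ≤ ∑ i, c i := fun i => by have := hg.add_lt i; omega
    obtain ⟨T₁, p, U, h₁, hpz, hU⟩ := Within.expose (c := c) hg.one_le hk (hc r) z hr
    have hT₁ := h₁.fits ⟨by simp, hT⟩
    obtain ⟨T₂, q, V, h₂, hqz, hV, hz₂⟩ := Within.empty (c := c) (T := T₁) hT₁.2 hg.one_le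
      (k := k) (by simpa [hk] using h₁.length_eq.symm) hc hpz
      (hg.exists_ne_ne (by omega) z p) hU
    have h₃ := Within.transfer (h := h) (c := c) (H := []) hV hqz (by simpa [hz₂] using hz)
      (by simpa using hg.one_le)
    exact ⟨_, [], ((h₁.trans h₂).trans h₃).mono (by omega), by simp [hz₂]⟩

theorem Within.place_single {T : ι → List α} (hk : ∑ i, (T i).length = 1) (hh : 1 ≤ h)
    {r z : ι} {A B : List α} {x : α} (hr : T r = A ++ x :: B) (hz : 0 < c z) :
    ∃ T' B', Within h c 2 ([], T) ([], T') ∧ T' z = B' ++ [x] := by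
  have hlen : ∀ i, (T i).length ≤ ∑ i, (T i).length := fun i =>
    Finset.single_le_sum (f := fun i => (T i).length) (fun i _ => Nat.zero_le _) (mem_univ i)
  have hlen_r := hlen r
  obtain rfl : A = [] := List.length_eq_zero_iff.1 (by simp [hr] at hlen_r; omega)
  obtain rfl : B = [] := List.length_eq_zero_iff.1 (by simp [hr] at hlen_r; omega)
  by_cases hrz : r = z
  · subst hrz
    exact ⟨T, [], .refl _ _, by simpa using hr⟩
  have hzr : T z = [] := by
    have h₂ := sum_eq_add_add_sum_compl (z := z) (p := r) hrz (fun i => (T i).length)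
    have h₃ : (T r).length = 1 := by simp [hr]
    exact List.length_eq_zero_iff.1 (by omega)
  exact ⟨_, [], Within.transfer (by simpa using hr) hrz (by simpa [hzr] using hz) (by simpa using hh),
    by simp [hzr]⟩

theorem sum_coe_pred {T : ι → List α} {z : ι} {B : List α} {x : α} (hz : T z = B ++ [x]) :
    (∑ i, (T i : Multiset α)) = (∑ i, (update T z B i : Multiset α)) + {x} := by
  rw [sum_coe_update, Fintype.sum_eq_add_sum_compl z (fun i => (T i : Multiset α)), hz,
    ← Multiset.coe_add, Multiset.coe_singleton]
  abel

/-- Wagons standing in the sidings of a good yard can be rearranged arbitrarily. -/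
theorem Within.rearrange (hh : 1 ≤ h) {T Q : ι → List α} (hT : ∀ i, (T i).length ≤ c i)
    (hQ : ∀ i, (Q i).length ≤ c i)
    (hTQ : (∑ i, (T i : Multiset α)) = ∑ i, (Q i : Multiset α)) (hk : ∑ i, (T i).length = k)
    (hg : 2 ≤ k → Good k h c) :
    Within h c (2 * k ^ 2 + 10 * k - 10) ([], T) ([], Q) := by
  induction k generalizing c T Q with
  | zero =>
    have hT0 : ∀ i, T i = [] := fun i => by
      simpa using (Finset.sum_eq_zero_iff.1 hk) i (mem_univ i)
    have hQ0 : ∀ i, Q i = [] := fun i => by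
      have : (∑ i, (Q i : Multiset α)) = 0 := by rw [← hTQ]; simp [hT0]
      simpa using (Finset.sum_eq_zero_iff.1 this) i (mem_univ i)
    obtain rfl : T = Q := funext fun i => by rw [hT0, hQ0]
    exact .refl _ _
  | succ k ih =>
    have hkQ : ∑ i, (Q i).length = k + 1 := by
      rw [← hk]; simpa using (congrArg Multiset.card hTQ).symm
    obtain ⟨z, hz, hgz⟩ : ∃ z, 0 < (Q z).length ∧ (2 ≤ k → Good k h (update c z (c z - 1))) := by
      by_cases hk2 : 2 ≤ k
      · obtain ⟨z, hz, hgz⟩ := (hg (by omega)).exists_pred hk2 hQ hkQ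
        exact ⟨z, hz, fun _ => hgz⟩
      · by_contra! hcon
        have : ∑ i, (Q i).length = 0 := Finset.sum_eq_zero fun i _ => by
          by_contra hi
          have := hcon i (by omega)
          omega
        omega
    obtain ⟨Q', x, hQz⟩ : ∃ Q' x, Q z = Q' ++ [x] :=
      ⟨_, _, (List.dropLast_append_getLast (List.ne_nil_of_length_pos hz)).symm⟩
    obtain ⟨r, A, B, hr⟩ : ∃ r A B, T r = A ++ x :: B := by
      have hx : x ∈ ∑ i, (T i : Multiset α) := by rw [hTQ, sum_coe_pred hQz]; simp
      obtain ⟨r, -, hr⟩ := Multiset.mem_sum.1 hx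
      obtain ⟨A, B, hr⟩ := List.append_of_mem (Multiset.mem_coe.1 hr)
      exact ⟨r, A, B, hr⟩
    have hcz : 0 < c z := hz.trans_le (hQ z)
    -- The bound grows by 4(k + 1) + 8 when k ≥ 1. For the first wagon truncated subtraction makes
    -- the old bound 0 and the increment 2, one transfer.
    obtain ⟨n, T₁, B', hn, h₁, hB'⟩ : ∃ n T₁ B', n + (2 * k ^ 2 + 10 * k - 10) ≤
        2 * (k + 1) ^ 2 + 10 * (k + 1) - 10 ∧ Within h c n ([], T) ([], T₁) ∧
        T₁ z = B' ++ [x] := by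
      rcases k with _ | k
      · obtain ⟨T₁, B', h₁, hB'⟩ := Within.place_single (c := c) hk hh hr hcz
        exact ⟨2, T₁, B', by simp, h₁, hB'⟩
      · obtain ⟨T₁, B', h₁, hB'⟩ := Within.place (c := c) hT hk (by omega) (hg (by omega)) hr hcz
        exact ⟨_, T₁, B', by ring_nf; omega, h₁, hB'⟩
    have hT₁ := (h₁.fits ⟨by simp, hT⟩).2
    simp only at hT₁
    have hTQ₁ : (∑ i, (T₁ i : Multiset α)) = ∑ i, (Q i : Multiset α) := by
      rw [← hTQ]; simpa [contents] using h₁.contents_eq.symm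
    have hTQ₂ : (∑ i, (update T₁ z B' i : Multiset α)) = ∑ i, (update Q z Q' i : Multiset α) := by
      rw [sum_coe_pred hB', sum_coe_pred hQz] at hTQ₁
      exact add_right_cancel hTQ₁
    have hk₁ : ∑ i, (update T₁ z B' i).length = k := by
      have := congrArg Multiset.card hTQ₂
      have h₂ := congrArg Multiset.card (sum_coe_pred hQz)
      simp at this h₂
      omega
    have h₂ := (ih (length_update_le hT₁ hB') (length_update_le hQ hQz) hTQ₂ hk₁ hgz).append_bottom
      (c := c) (update (fun _ => []) z [x]) (fun i => by
        by_cases hi : i = z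
        · subst hi; simp; omega
        · simp [hi])
    simp only [update_append_bottom hB', update_append_bottom hQz] at h₂
    exact (h₁.trans h₂).mono hn

end Rearrange

/-! ### From yards to positions and walks -/

section Position

variable {W : Type*} {s h : ℕ} {m : Fin s → ℕ}

/-- The headshunt and the sidings of a position. -/
def Position.yard (p : Position W h m) : List W × (Fin s → List W) :=
  (p.track 0, fun i => p.track i.succ)

theorem Position.yard_injective : Injective (Position.yard : Position W h m → _) := by
  intro p q hpq
  ext1
  funext i
  refine Fin.cases ?_ (fun i => ?_) i
  · exact congrArg Prod.fst hpq
  · exact congrFun (congrArg Prod.snd hpq) i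

theorem Position.fits (p : Position W h m) : Fits h m p.yard :=
  ⟨p.headshunt_le, p.siding_le⟩

theorem Position.disjoint_headshunt (p : Position W h m) (i : Fin s) {a : W}
    (h₀ : a ∈ p.track 0) (hi : a ∈ p.track i.succ) : False :=
  p.disjoint 0 i.succ (Fin.succ_ne_zero i).symm h₀ hi

theorem Step.isMove {p q : Position W h m} (hpq : Step h m p.yard q.yard) :
    p = q ∨ IsMove p q := by
  have key : ∀ {x y : List W × (Fin s → List W)}, Step h m x y →
      ∃ r, (∀ i, i ≠ r → x.2 i = y.2 i) ∧ x.1 ++ x.2 r = y.1 ++ y.2 r := by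
    intro x y hxy
    cases hxy with
    | pull H A B T r hT hA => exact ⟨r, fun i hi => by simp [hi], by simp [hT]⟩
    | push H A T r hA => exact ⟨r, fun i hi => by simp [hi], by simp⟩
  by_cases hne : p = q
  · exact Or.inl hne
  · exact Or.inr ⟨hne, key hpq⟩

theorem contents_eq_sum (y : List W × (Fin s → List W)) :
    contents y = ∑ i, ((Fin.cons y.1 y.2 : Fin (s + 1) → List W) i : Multiset W) := by
  rw [Fin.sum_univ_succ]
  rfl

variable [Fintype W]

theorem Position.contents_yard (p : Position W h m) : contents p.yard = (univ : Finset W).val := by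
  classical
  have hsum : contents p.yard = ∑ i, (p.track i : Multiset W) := by
    rw [Fin.sum_univ_succ]; rfl
  ext a
  obtain ⟨i, hi⟩ := p.cover a
  rw [hsum, Multiset.count_sum', Finset.sum_eq_single i,
    Multiset.count_eq_one_of_mem (Multiset.coe_nodup.2 (p.nodup i)) hi,
    Multiset.count_eq_one_of_mem univ.nodup (by simp)]
  · intro j _ hj
    exact Multiset.count_eq_zero_of_notMem fun haj => p.disjoint i j hj.symm hi haj
  · simp

theorem Position.length_add_sum (p : Position W h m) :
    (p.track 0).length + ∑ i : Fin s, (p.track i.succ).length = Fintype.card W := by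
  have := card_contents p.yard
  rw [p.contents_yard] at this
  exact this.symm

/-- Equality with the duplicate-free multiset of all wagons encodes covering, disjointness and
absence of repetitions at once. -/
theorem exists_position {y : List W × (Fin s → List W)} (hy : Fits h m y)
    (hc : contents y = (univ : Finset W).val) : ∃ p : Position W h m, p.yard = y := by
  classical
  rw [contents_eq_sum] at hc
  set t : Fin (s + 1) → List W := Fin.cons y.1 y.2 with ht
  have hnd : (∑ i, (t i : Multiset W)).Nodup := hc ▸ univ.nodup
  refine ⟨⟨t, fun i => ?_, fun a => ?_, fun i j hij a hi hj => ?_, hy.2, hy.1⟩, rfl⟩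
  · exact Multiset.coe_nodup.1 (Multiset.nodup_of_le
      (Finset.single_le_sum (f := fun i => (t i : Multiset W)) (fun _ _ => zero_le) (mem_univ i))
      hnd)
  · have : a ∈ ∑ i, (t i : Multiset W) := by rw [hc]; simp
    obtain ⟨i, -, hi⟩ := Multiset.mem_sum.1 this
    exact ⟨i, hi⟩
  · have hle : (t i : Multiset W) + t j ≤ ∑ i, (t i : Multiset W) := by
      rw [← Finset.sum_pair (f := fun i => (t i : Multiset W)) hij]
      exact Finset.sum_le_sum_of_subset (subset_univ _)
    exact Multiset.disjoint_left.1 (Multiset.nodup_add.1 (Multiset.nodup_of_le hle hnd)).2.2 hi hj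

/-- Intermediate yards are positions because shunts preserve track lengths and contents. Shunts of
an empty block are no moves and are skipped. -/
theorem Within.exists_walk {n : ℕ} {p q : Position W h m} (hpq : Within h m n p.yard q.yard) :
    ∃ γ : (graph W h m).Walk p q, γ.length ≤ n := by
  generalize hx : p.yard = x at hpq
  generalize hy : q.yard = y at hpq
  induction hpq generalizing q with
  | refl n x =>
    obtain rfl := Position.yard_injective (hx.trans hy.symm)
    exact ⟨.nil, by simp⟩
  | tail h₁ h₂ ih =>
    subst hx hy
    obtain ⟨q', hq'⟩ := exists_position (h₁.fits p.fits) (h₁.contents_eq ▸ p.contents_yard)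
    obtain ⟨γ, hγ⟩ := ih rfl hq'
    rw [← hq'] at h₂
    rcases h₂.isMove with rfl | hmove
    · exact ⟨γ, by omega⟩
    · have hadj : (graph W h m).Adj q' q := hmove
      exact ⟨γ.concat hadj, by rw [SimpleGraph.Walk.length_concat]; omega⟩

theorem exists_walk_clear (p : Position W h m) (hw : Fintype.card W ≤ ∑ i, m i) :
    ∃ (q : Position W h m) (γ : (graph W h m).Walk p q), q.track 0 = [] ∧
      γ.length ≤ Fintype.card W := by
  obtain ⟨T, hT⟩ := Within.clear_headshunt (h := h) (c := m) (p.track 0)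
    (fun i => p.track i.succ) (by rw [p.length_add_sum]; exact hw)
  change Within h m _ p.yard _ at hT
  obtain ⟨q, hq⟩ := exists_position (hT.fits p.fits) (hT.contents_eq ▸ p.contents_yard)
  rw [← hq] at hT
  obtain ⟨γ, hγ⟩ := hT.exists_walk
  have := p.length_add_sum
  exact ⟨q, γ, congrArg Prod.fst hq, by omega⟩

theorem exists_walk_of_good (hh : 1 ≤ h) (hw : 1 ≤ Fintype.card W)
    (hwm : Fintype.card W ≤ ∑ i, m i) (hg : 2 ≤ Fintype.card W → Good (Fintype.card W) h m)
    (p q : Position W h m) : ∃ γ : (graph W h m).Walk p q,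
      γ.length + 10 ≤ 2 * Fintype.card W ^ 2 + 12 * Fintype.card W := by
  obtain ⟨p', γ₁, hp', h₁⟩ := exists_walk_clear p hwm
  obtain ⟨q', γ₂, hq', h₂⟩ := exists_walk_clear q hwm
  have hpc := p'.contents_yard
  have hqc := q'.contents_yard
  have hlen := p'.length_add_sum
  have h₃ := Within.rearrange (c := m) (Q := fun i => q'.track i.succ) hh p'.siding_le q'.siding_le
    (by simpa [contents, Position.yard, hp', hq'] using hpc.trans hqc.symm)
    (k := Fintype.card W) (by simpa [hp'] using hlen) hg
  have hp : p'.yard = ([], fun i => p'.track i.succ) := Prod.ext hp' rfl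
  have hq : q'.yard = ([], fun i => q'.track i.succ) := Prod.ext hq' rfl
  rw [← hp, ← hq] at h₃
  obtain ⟨γ₃, h₄⟩ := h₃.exists_walk
  refine ⟨(γ₁.append γ₃).append γ₂.reverse, ?_⟩
  simp only [SimpleGraph.Walk.length_append, SimpleGraph.Walk.length_reverse]
  omega

end Position

/-! ### Invariants forcing a good yard -/

section Natural

variable {W : Type*} [Fintype W] {s h : ℕ} {m : Fin s → ℕ}

/-- In a natural puzzle an invariant wagon that follows the permutations of the wagons can be
prescribed in a finishing position. -/
theorem Puzzle.IsNatural.exists_finish {P : Puzzle W} (hP : P.AlwaysSolvable)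
    (hS : ∀ p ∈ P.S, ∀ σ : Equiv.Perm W, p.permute σ ∈ P.S) {p : Position W P.h P.m} (hp : p ∈ P.S)
    (f : Position W P.h P.m → Option W) (hf : ∀ p q, IsMove p q → f p = f q)
    (hσ : ∀ σ p, f (Position.permute σ p) = (f p).map σ) (hfp : f p ≠ none) (b : W) :
    ∃ q ∈ P.F, f q = some b := by
  classical
  obtain ⟨y, hy⟩ := Option.ne_none_iff_exists'.1 hfp
  obtain ⟨q, hq, ⟨γ⟩⟩ := hP _ (hS p hp (Equiv.swap y b))
  have hγ : ∀ {x y : Position W P.h P.m}, P.graph.Walk x y → f x = f y := by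
    intro x y γ
    induction γ with
    | nil => rfl
    | cons hadj _ ih => exact (hf _ _ hadj).trans ih
  exact ⟨q, hq, by rw [← hγ γ, hσ, hy]; simp⟩

/-- The headshunt is never empty, so the wagon next to the engine stays there forever. -/
theorem head_eq_of_isMove (hw : ∑ i, m i < Fintype.card W) {p q : Position W h m}
    (hpq : IsMove p q) : (p.track 0).head? = (q.track 0).head? := by
  have hne : ∀ p : Position W h m, p.track 0 ≠ [] := by
    intro p hp
    have := p.length_add_sum
    have h₂ := Finset.sum_le_sum fun i (_ : i ∈ univ) => p.siding_le i
    simp [hp] at this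
    omega
  obtain ⟨-, r, -, hr⟩ := hpq
  have := congrArg List.head? hr
  rwa [List.head?_append_of_ne_nil _ (hne p), List.head?_append_of_ne_nil _ (hne q)] at this

theorem length_headshunt_of_siding_eq_nil {z : Fin s}
    (hz : h + ∑ i, m i ≤ Fintype.card W + m z) {p : Position W h m} (hp : p.track z.succ = []) :
    (p.track 0).length = h := by
  have h₁ := p.length_add_sum
  have h₂ := Finset.sum_le_sum fun i (_ : i ∈ ({z} : Finset (Fin s))ᶜ) => p.siding_le i
  rw [Fintype.sum_eq_add_sum_compl z] at h₁ hz
  have h₃ := p.headshunt_le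
  simp [hp] at h₁
  omega

/-- A nonempty siding `z` keeps its last wagon while another siding is worked. If `z` is empty, the
headshunt is full before and after such a move, hence unchanged. -/
theorem getLast_eq_of_isMove {z : Fin s} (hz : h + ∑ i, m i ≤ Fintype.card W + m z)
    {p q : Position W h m} (hpq : IsMove p q) :
    (p.track 0 ++ p.track z.succ).getLast? = (q.track 0 ++ q.track z.succ).getLast? := by
  obtain ⟨-, r, hr, hr'⟩ := hpq
  by_cases hzr : z = r
  · subst hzr; rw [hr']
  have hpq := hr z hzr
  by_cases hp : p.track z.succ = []
  · have hlen := (length_headshunt_of_siding_eq_nil hz hp).trans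
      (length_headshunt_of_siding_eq_nil hz (hpq ▸ hp)).symm
    rw [(List.append_inj hr' hlen).1, hpq]
  · rw [List.getLast?_append_of_ne_nil _ hp, List.getLast?_append_of_ne_nil _ (hpq ▸ hp), hpq]

theorem reverse_eq_self_of_length_le_one {α : Type*} {l : List α} (hl : l.length ≤ 1) :
    l.reverse = l := by
  match l, hl with
  | [], _ => rfl
  | [_], _ => rfl

/-- A headshunt with at most one wagon reads the same both ways, so the whole yard is one line on
which the wagons never change order. -/
theorem line_eq_of_isMove {W : Type*} {s : ℕ} {m : Fin s → ℕ} {o z : Fin s} (hoz : o ≠ z) (hs : ∀ i, i = z ∨ i = o)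
    {p q : Position W 1 m} (hpq : IsMove p q) :
    (p.track o.succ).reverse ++ (p.track 0 ++ p.track z.succ) =
      (q.track o.succ).reverse ++ (q.track 0 ++ q.track z.succ) := by
  obtain ⟨-, r, hr, hr'⟩ := hpq
  rcases hs r with rfl | rfl
  · rw [hr', hr o hoz]
  · have := congrArg List.reverse hr'
    rw [List.reverse_append, List.reverse_append,
      reverse_eq_self_of_length_le_one p.headshunt_le,
      reverse_eq_self_of_length_le_one q.headshunt_le] at this
    rw [← List.append_assoc, ← List.append_assoc, this, hr z hoz.symm]

theorem Puzzle.IsNatural.good {P : Puzzle W} (hN : P.IsNatural) (hP : P.AlwaysSolvable)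
    {p : Position W P.h P.m} (hp : p ∈ P.S) (hw : 2 ≤ Fintype.card W) :
    Good (Fintype.card W) P.h P.m := by
  obtain ⟨hS, z, ω, hF⟩ := hN
  obtain ⟨b, hb⟩ := Fintype.exists_ne_of_one_lt_card (by omega) ω
  have hω : ∀ q ∈ P.F, ω ∈ q.track z.succ := fun q hq => List.mem_of_getLast? (hF q hq)
  have hzne : ∀ q ∈ P.F, q.track z.succ ≠ [] := fun q hq => List.ne_nil_of_mem (hω q hq)
  have hh := P.h_pos
  have hlt : ∀ i, Fintype.card W + P.m i < P.h + ∑ i, P.m i := by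
    intro i
    by_contra! hi
    obtain ⟨q, hq, hqb⟩ := exists_finish hP hS hp
      (fun p => (p.track 0 ++ p.track i.succ).getLast?) (fun _ _ => getLast_eq_of_isMove hi)
      (fun σ p => by simp [Position.permute, ← List.map_append, List.getLast?_map])
      (fun hnil => by
        simp only [List.getLast?_eq_none_iff, List.append_eq_nil_iff] at hnil
        have := length_headshunt_of_siding_eq_nil hi hnil.2
        simp [hnil.1] at this
        omega)
      -- For `i = z` the last wagon would have to be both `b` and `ω`; for `i ≠ z` the wagon `ω`
      -- would stand outside `z`.
      (if i = z then b else ω)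
    by_cases hiz : i = z
    · subst hiz
      rw [List.getLast?_append_of_ne_nil _ (hzne q hq), hF q hq] at hqb
      simp at hqb
      exact hb hqb.symm
    · have hmem := List.mem_of_getLast? hqb
      rw [if_neg hiz, List.mem_append] at hmem
      rcases hmem with hmem | hmem
      · exact q.disjoint_headshunt z hmem (hω q hq)
      · exact q.disjoint _ _ (fun e => hiz (Fin.succ_injective _ e)) hmem (hω q hq)
  refine ⟨hh, ?_, hlt, ?_⟩
  · by_contra! hsum
    obtain ⟨q, hq, hqb⟩ := exists_finish hP hS hp (fun p => (p.track 0).head?)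
      (fun _ _ => head_eq_of_isMove hsum) (fun σ p => by simp [Position.permute])
      (fun hnil => by
        have h₁ := p.length_add_sum
        have h₂ := Finset.sum_le_sum fun i (_ : i ∈ univ) => p.siding_le i
        simp at hnil
        simp [hnil] at h₁
        omega) ω
    exact q.disjoint_headshunt z (List.mem_of_mem_head? hqb) (hω q hq)
  · have hcard : #{i | 0 < P.m i} = P.s := by
      rw [Finset.filter_true_of_mem fun i _ => P.m_pos i]; simp
    rw [hcard]
    by_contra! hs
    have hs0 := P.s_pos
    by_cases hs1 : P.s = 1
    · have hz : ∀ i, i = z := fun i => Fin.ext (by omega)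
      obtain ⟨q, hq, hqb⟩ := exists_finish hP hS hp
        (fun p => (p.track 0 ++ p.track z.succ).getLast?)
        (fun p q hpq => by obtain ⟨-, r, -, hr⟩ := hpq; rw [hz r] at hr; simp only [hr])
        (fun σ p => by simp [Position.permute, ← List.map_append, List.getLast?_map])
        (fun hnil => by
          simp only [List.getLast?_eq_none_iff, List.append_eq_nil_iff] at hnil
          have h₁ := p.length_add_sum
          rw [Finset.sum_eq_zero fun i _ => by rw [hz i, hnil.2]; rfl, hnil.1] at h₁
          simp at h₁
          omega) b
      rw [List.getLast?_append_of_ne_nil _ (hzne q hq), hF q hq] at hqb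
      simp at hqb
      exact hb hqb.symm
    · obtain ⟨hs2, hh1⟩ : P.s = 2 ∧ P.h = 1 := by omega
      obtain ⟨o, hoz⟩ : ∃ o, o ≠ z := ⟨⟨1 - z, by omega⟩, fun e => by
        have := congrArg Fin.val e
        simp at this
        omega⟩
      have ho : ∀ i, i = z ∨ i = o := fun i => by
        have : (o : ℕ) ≠ z := fun e => hoz (Fin.ext e)
        simp only [Fin.ext_iff]
        omega
      obtain ⟨q, hq, hqb⟩ := exists_finish hP hS hp
        (fun p => ((p.track o.succ).reverse ++ (p.track 0 ++ p.track z.succ)).getLast?)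
        (fun p q hpq => by
          have : ∀ h (_ : h = 1) (p q : Position W h P.m), IsMove p q →
              (p.track o.succ).reverse ++ (p.track 0 ++ p.track z.succ) =
              (q.track o.succ).reverse ++ (q.track 0 ++ q.track z.succ) := by
            rintro _ rfl p q hpq
            exact line_eq_of_isMove hoz ho hpq
          simp only [this _ hh1 p q hpq])
        (fun σ p => by
          simp [Position.permute, ← List.map_append, ← List.map_reverse, List.getLast?_map])
        (fun hnil => by
          simp only [List.getLast?_eq_none_iff, List.append_eq_nil_iff,
            List.reverse_eq_nil_iff] at hnil
          have h₁ := p.length_add_sum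
          rw [Finset.sum_eq_zero fun i _ => by
            rcases ho i with rfl | rfl
            · rw [hnil.2.2]; rfl
            · rw [hnil.1]; rfl, hnil.2.1] at h₁
          simp at h₁
          omega) b
      rw [List.getLast?_append_of_ne_nil _ (by simp [hzne q hq]),
        List.getLast?_append_of_ne_nil _ (hzne q hq), hF q hq] at hqb
      simp at hqb
      exact hb hqb.symm

theorem Puzzle.IsNatural.exists_walk {P : Puzzle W} (hN : P.IsNatural) (hP : P.AlwaysSolvable)
    {p : Position W P.h P.m} (hp : p ∈ P.S) :
    ∃ q ∈ P.F, ∃ γ : P.graph.Walk p q,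
      γ.length + 10 ≤ 2 * Fintype.card W ^ 2 + 12 * Fintype.card W := by
  obtain ⟨q, hq, -⟩ := hP p hp
  have hg := hN.good hP hp
  have hs : P.s ≤ ∑ i, P.m i := by
    simpa using Finset.sum_le_sum fun i (_ : i ∈ univ) => Nat.succ_le_of_lt (P.m_pos i)
  have hs0 := P.s_pos
  refine ⟨q, hq, exists_walk_of_good P.h_pos P.wagons_pos ?_ hg p q⟩
  by_cases hw : 2 ≤ Fintype.card W
  · exact (hg hw).le_sum
  · omega

end Natural

/-! ### Inversions of lists -/

section Inversions

/-- The number of inversions of a list. -/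
def inversions : List ℕ → ℕ
  | [] => 0
  | a :: l => l.countP (· < a) + inversions l

theorem inversions_swap_le (X Y : List ℕ) (a b : ℕ) :
    inversions (X ++ a :: b :: Y) ≤ inversions (X ++ b :: a :: Y) + 1 := by
  induction X with
  | nil =>
    simp only [List.nil_append, inversions, List.countP_cons]
    split_ifs <;> omega
  | cons x X ih =>
    have hperm : (X ++ a :: b :: Y).Perm (X ++ b :: a :: Y) :=
      (List.Perm.swap b a Y).append_left X
    simp only [List.cons_append, inversions, hperm.countP_eq]
    omega

theorem inversions_reverse_le (X Y : List ℕ) {l : List ℕ} (hl : l.length ≤ 2) :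
    inversions (X ++ (l ++ Y)) ≤ inversions (X ++ (l.reverse ++ Y)) + 1 := by
  match l, hl with
  | [], _ => simp
  | [_], _ => simp
  | [a, b], _ => simpa using inversions_swap_le X Y a b

theorem inversions_reverse_eq (X Y : List ℕ) {l : List ℕ} (hl : l.length ≤ 1) :
    inversions (X ++ (l.reverse ++ Y)) = inversions (X ++ (l ++ Y)) := by
  rw [reverse_eq_self_of_length_le_one hl]

theorem inversions_eq_zero {l : List ℕ} (hl : l.Pairwise (· < ·)) : inversions l = 0 := by
  induction hl with
  | nil => rfl
  | cons ha _ ih =>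
    simp only [inversions, ih, add_zero, List.countP_eq_zero, decide_eq_true_eq]
    exact fun x hx => by have := ha x hx; omega

theorem two_mul_inversions_add_length {l : List ℕ} (hl : l.Pairwise (· > ·)) :
    2 * inversions l + l.length = l.length ^ 2 := by
  induction hl with
  | nil => rfl
  | @cons a l ha _ ih =>
    have : l.countP (· < a) = l.length :=
      List.countP_eq_length.2 fun x hx => by simpa using ha x hx
    simp only [inversions, this, List.length_cons]
    nlinarith

end Inversions

/-! ### A puzzle needing quadratically many moves -/

section LowerBound

variable {W : Type*} {h : ℕ} {m : Fin 2 → ℕ}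

/-- With two sidings all wagons form a line, in which the wagons of the headshunt may be read in
either direction. The disorder counts the inversions of both readings. -/
def disorder (f : W → ℕ) (p : Position W h m) : ℕ :=
  inversions (((p.track 1).reverse ++ (p.track 0 ++ p.track 2)).map f) +
    inversions (((p.track 1).reverse ++ ((p.track 0).reverse ++ p.track 2)).map f)

/-- A move preserves one of the two readings; which one depends on the siding worked. The other
reading comes from it by reversing the headshunt, and this changes the inversions by at most one at
either end of the move. -/
theorem disorder_le_of_isMove (f : W → ℕ) {p q : Position W 2 m} (hpq : IsMove p q) :
    disorder f p ≤ disorder f q + 1 := by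
  obtain ⟨hne, r, hr, hr'⟩ := hpq
  -- Two headshunts of length 2 would make the positions equal. So at one end of the move both
  -- readings agree, and the total change is at most one rather than two.
  have hlen : (p.track 0).length ≤ 1 ∨ (q.track 0).length ≤ 1 := by
    by_contra! hlen
    have hp := p.headshunt_le
    have hq := q.headshunt_le
    obtain ⟨h₀, h₁⟩ := List.append_inj hr' (by omega)
    refine hne (Position.yard_injective (Prod.ext h₀ (funext fun i => ?_)))
    by_cases hi : i = r
    · subst hi; exact h₁
    · exact hr i hi
  have aux : ∀ X Y X' Y' l l' : List ℕ, l.length ≤ 2 → l'.length ≤ 2 →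
      (l.length ≤ 1 ∨ l'.length ≤ 1) → X ++ (l ++ Y) = X' ++ (l' ++ Y') →
      inversions (X ++ (l ++ Y)) + inversions (X ++ (l.reverse ++ Y)) ≤
        inversions (X' ++ (l' ++ Y')) + inversions (X' ++ (l'.reverse ++ Y')) + 1 := by
    intro X Y X' Y' l l' hl hl' hor heq
    rw [heq]
    rcases hor with h₁ | h₁
    · have := inversions_reverse_le X' Y' hl'
      rw [inversions_reverse_eq X Y h₁, heq]
      omega
    · have := inversions_reverse_le X Y (l := l.reverse) (by simpa using hl)
      rw [List.reverse_reverse, heq] at this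
      rw [inversions_reverse_eq X' Y' h₁]
      omega
  have hp : ((p.track 0).map f).length ≤ 2 := by simpa using p.headshunt_le
  have hq : ((q.track 0).map f).length ≤ 2 := by simpa using q.headshunt_le
  rw [← List.length_map (f := f), ← List.length_map (f := f) (as := q.track 0)] at hlen
  simp only [disorder, List.map_append, List.map_reverse]
  have hrev := congrArg (fun l => (l.map f).reverse) hr'
  have hmap := congrArg (List.map f) hr'
  simp only [List.map_append, List.reverse_append] at hrev hmap
  obtain rfl | rfl : r = 0 ∨ r = 1 := by omega
  · have h₂ : p.track 2 = q.track 2 := hr 1 (by decide)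
    have := aux ((p.track 1).map f).reverse ((p.track 2).map f) ((q.track 1).map f).reverse
      ((q.track 2).map f) ((p.track 0).map f).reverse ((q.track 0).map f).reverse (by simpa using hp)
      (by simpa using hq) (by simpa using hlen) (by
        rw [← List.append_assoc, ← List.append_assoc, h₂]
        exact congrArg (· ++ _) hrev)
    rw [List.reverse_reverse, List.reverse_reverse] at this
    omega
  · have h₁ : p.track 1 = q.track 1 := hr 0 (by decide)
    exact aux _ _ _ _ _ _ hp hq hlen (by rw [h₁]; exact congrArg (_ ++ ·) hmap)

theorem disorder_le_of_walk (f : W → ℕ) {p q : Position W 2 m} (γ : (graph W 2 m).Walk p q) :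
    disorder f p ≤ disorder f q + γ.length := by
  induction γ with
  | nil => simp
  | cons hadj _ ih =>
    have := disorder_le_of_isMove f hadj
    simp only [SimpleGraph.Walk.length_cons]
    omega

/-- Each siding is long enough for all wagons, and the only finishing position is the reversal of
the chosen start. -/
theorem exists_natural_puzzle (W : Type*) [Fintype W] (hw : 1 ≤ Fintype.card W) :
    ∃ P : Puzzle W, P.IsNatural ∧ P.AlwaysSolvable ∧ ∃ p ∈ P.S, ∀ q ∈ P.F,
      ∀ γ : P.graph.Walk p q, Fintype.card W ^ 2 ≤ γ.length + Fintype.card W := by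
  classical
  set w := Fintype.card W with hW
  let e : W ≃ Fin w := Fintype.equivFin W
  let f : W → ℕ := fun a => e a
  let l : List W := (List.finRange w).map e.symm
  have hlf : l.map f = List.range w := by
    rw [← List.map_coe_finRange_eq_range]
    simp [l, f, Function.comp_def]
  have hlen : l.length = w := by simp [l]
  have hl : (l : Multiset W) = (univ : Finset W).val := by
    have hnd : (l : Multiset W).Nodup :=
      Multiset.coe_nodup.2 ((List.nodup_finRange w).map e.symm.injective)
    exact (Multiset.Nodup.ext hnd univ.nodup).2 fun a => by
      simp only [Multiset.mem_coe, Finset.mem_val, mem_univ, iff_true]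
      exact List.mem_map.2 ⟨e a, List.mem_finRange _, by simp⟩
  let m : Fin 2 → ℕ := fun _ => w
  have hpos : ∀ l' : List W, l'.Perm l → ∃ p : Position W 2 m, p.yard = ([], ![[], l']) := by
    intro l' hl'
    refine exists_position ⟨by simp, fun i => ?_⟩ ?_
    · fin_cases i <;> simp [m, hl'.length_eq, hlen]
    · rw [← hl]
      simpa [contents] using hl'
  obtain ⟨p, hp⟩ := hpos l.reverse l.reverse_perm
  obtain ⟨q, hq⟩ := hpos l (List.Perm.refl l)
  have htrack : ∀ {p : Position W 2 m} {l' : List W}, p.yard = ([], ![[], l']) →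
      p.track 0 = [] ∧ p.track 1 = [] ∧ p.track 2 = l' := fun hp =>
    ⟨congrArg Prod.fst hp, congrFun (congrArg Prod.snd hp) 0, congrFun (congrArg Prod.snd hp) 1⟩
  obtain ⟨hp₀, hp₁, hp₂⟩ := htrack hp
  obtain ⟨hq₀, hq₁, hq₂⟩ := htrack hq
  have hlow : ∀ q' : Position W 2 m, q' = q → ∀ γ : (graph W 2 m).Walk p q',
      w ^ 2 ≤ γ.length + w := by
    intro q' hq' γ
    rw [← hq'] at hq₀ hq₁ hq₂
    have h₁ := disorder_le_of_walk f γ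
    have h₂ : disorder f q' = 0 := by
      simp [disorder, hq₀, hq₁, hq₂, hlf, inversions_eq_zero List.pairwise_lt_range]
    have h₃ := two_mul_inversions_add_length
      (l := (List.range w).reverse) (List.pairwise_reverse.2 List.pairwise_lt_range)
    have h₄ : disorder f p = 2 * inversions (List.range w).reverse := by
      simp [disorder, hp₀, hp₁, hp₂, hlf, List.map_reverse]
      omega
    simp only [List.length_reverse, List.length_range] at h₃
    omega
  have hlne : l ≠ [] := List.ne_nil_of_length_pos (by omega)
  refine ⟨⟨2, 2, m, hw, by norm_num, by norm_num, fun _ => hw, by simp [m]; omega, Set.univ, {q}⟩,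
    ⟨fun _ _ _ => Set.mem_univ _, 1, l.getLast hlne, ?_⟩, ?_, p, Set.mem_univ _, ?_⟩
  · intro q' hq'
    exact (congrArg (fun x : Position W 2 m => (x.track 2).getLast?) hq').trans
      ((congrArg List.getLast? hq₂).trans (List.getLast?_eq_some_getLast hlne))
  · intro p' _
    obtain ⟨γ, -⟩ := exists_walk_of_good (W := W) (h := 2) (m := m) (by norm_num) hw
      (by simp [m]; omega) (fun _ => ⟨by norm_num, by simp [m]; omega,
        fun i => by simp [m]; omega, Or.inl ⟨le_rfl, by
          simp [m, Nat.lt_of_succ_le hw]⟩⟩) p' q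
    exact ⟨q, rfl, ⟨γ⟩⟩
  · intro q' hq' γ
    exact hlow q' hq' γ

end LowerBound

end Inglenook

theorem mainTheorem3 (w : ℕ) (hw : 1 ≤ w) (W : Type*) [Fintype W] (hW : Fintype.card W = w) :
    (∀ P : Inglenook.Puzzle W, P.IsNatural → P.AlwaysSolvable →
      ∀ p ∈ P.S, ∃ q ∈ P.F, ∃ γ : P.graph.Walk p q,
        (γ.length : ℝ) ≤ 2 * (w : ℝ) ^ 2 + 12 * (w : ℝ) - 10) ∧
    (∃ P : Inglenook.Puzzle W, P.IsNatural ∧ P.AlwaysSolvable ∧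
      ∃ p ∈ P.S, ∀ q ∈ P.F, ∀ γ : P.graph.Walk p q,
        ((w : ℝ) ^ 2 - 1) / 2 ≤ (γ.length : ℝ)) := by
  subst hW
  constructor
  · intro P hN hP p hp
    obtain ⟨q, hq, γ, hγ⟩ := hN.exists_walk hP hp
    refine ⟨q, hq, γ, ?_⟩
    have : ((γ.length + 10 : ℕ) : ℝ) ≤ (2 * Fintype.card W ^ 2 + 12 * Fintype.card W : ℕ) := by
      exact_mod_cast hγ
    push_cast at this
    linarith
  · obtain ⟨P, hN, hP, p, hp, hlow⟩ := Inglenook.exists_natural_puzzle W hw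
    refine ⟨P, hN, hP, p, hp, fun q hq γ => ?_⟩
    have : ((Fintype.card W ^ 2 : ℕ) : ℝ) ≤ (γ.length + Fintype.card W : ℕ) := by
      exact_mod_cast hlow q hq γ
    push_cast at this
    -- The difference between w² - w and (w² - 1)/2 is (w - 1)²/2.
    nlinarith [sq_nonneg ((Fintype.card W : ℝ) - 1)]
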